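/- Let $q$ be an indeterminate, and for $m\ge 0$ let $[m]_q=1+q+\dots+q^{m-1}$ (so $[0]_q=0$). For integers $k\ge 0$ and $n\ge 1$ define the $q$-Eulerian numbers $$\hat E_{k,n}(q)=q^{k-k^2}\sum_{i=0}^{k-1}(-1)^i\,[k-i]_q^{\,n}\,q^{k(i-1)}\left(\binom{n}{i}q^{k-i}+\binom{n}{i-1}\right)\in\mathbb Z[q,q^{-1}],$$ where $\binom{n}{-1}=0$, and put $\hat E_{0,0}(q)=1$ and $\hat E_{k,0}(q)=0$ for $k\ge 1$. Let $E_{k,n}(q)=q^{n-k}\hat E_{k,n}(q)$ and $$A_{k,n}(q)=\sum_{i=0}^{n}\binom{n}{i}E_{k,n-i}(q)\qquad(k,n\ge 0).$$ **Corollary.** As a formal power series in $x$ and $y$ over $\mathbb Z[q,q^{-1}]$, the generating function $A(q,x,y)=\sum_{n,k\ge 0}A_{k,n}(q)\,x^n y^k$ satisfies $$A(q,x,y)=\cfrac{1}{1-b_0x-\cfrac{\lambda_1x^2}{1-b_1x-\cfrac{\lambda_2x^2}{1-b_2x-\cfrac{\lambda_3x^2}{\ddots}}}}$$ with $b_n=(1+y)[n+1]_q$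 for $n\ge 0$ and $\lambda_n=y\,q\,[n]_q^2$ for $n\ge 1$. Here the infinite continued fraction is the limit of its finite convergents, coefficientwise in the powers of $x$. -/

import Mathlib

open LaurentPolynomial PowerSeries Filter

noncomputable section

namespace QEulerian

/-- The `q`-integer `[n]_q = 1 + q + ⋯ + q^(n-1)`, an element of `ℤ[q, q⁻¹]`, where `q = T 1`. -/
def qInt (n : ℕ) : ℤ[T;T⁻¹] :=
  ∑ i ∈ Finset.range n, T (i : ℤ)

/-- The binomial coefficient `n choose (i - 1)`, equal to `0` for `i = 0`. -/
def choosePred (n i : ℕ) : ℕ :=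
  if i = 0 then 0 else n.choose (i - 1)

/-- The `q`-Eulerian numbers `Ê_{k,n}(q)`: for `n ≥ 1`
`q^(k-k²) ∑_{i=0}^{k-1} (-1)^i [k-i]_q^n q^(k(i-1)) (C(n,i) q^(k-i) + C(n,i-1))`,
and `Ê_{0,0} = 1`, `Ê_{k,0} = 0` for `k ≥ 1`. -/
def hatE (k n : ℕ) : ℤ[T;T⁻¹] :=
  if n = 0 then (if k = 0 then 1 else 0)
  else
    T ((k : ℤ) - (k : ℤ) ^ 2) *
      ∑ i ∈ Finset.range k,
        (-1) ^ i * qInt (k - i) ^ n * T ((k : ℤ) * ((i : ℤ) - 1)) *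
          ((n.choose i : ℤ[T;T⁻¹]) * T ((k : ℤ) - (i : ℤ)) + (choosePred n i : ℤ[T;T⁻¹]))

/-- `E_{k,n}(q) = q^(n-k) Ê_{k,n}(q)`. -/
def E (k n : ℕ) : ℤ[T;T⁻¹] :=
  T ((n : ℤ) - (k : ℤ)) * hatE k n

/-- `A_{k,n}(q) = ∑_{i=0}^{n} C(n,i) E_{k,n-i}(q)`. -/
def A (k n : ℕ) : ℤ[T;T⁻¹] :=
  ∑ i ∈ Finset.range (n + 1), (n.choose i : ℤ[T;T⁻¹]) * E k (n - i)

/-- The generating function `A(q,x,y) = ∑_{n,k} A_{k,n}(q) x^n y^k`, as a formal power series in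
the outer variable `x`, whose coefficients are formal power series in the inner variable `y`
over `ℤ[q, q⁻¹]`. -/
def genA : (ℤ[T;T⁻¹])⟦X⟧⟦X⟧ :=
  PowerSeries.mk fun n => PowerSeries.mk fun k => A k n

section JFraction

/-- The convergent with `N` levels of the J-fraction that starts at level `m`:
`1 / (1 - b_m x - λ_{m+1} x² / (1 - b_{m+1} x - ⋯ - λ_{m+N-1} x² / (1 - b_{m+N-1} x)))`,
and `0` for `N = 0`. Every denominator has constant coefficient `1`, so that it is invertible. -/
def jConvergent {R : Type*} [CommRing R] (b lam : ℕ → R) : ℕ → ℕ → R⟦X⟧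
  | 0, _ => 0
  | N + 1, m =>
    PowerSeries.invOfUnit
      (1 - PowerSeries.C (b m) * X
        - PowerSeries.C (lam (m + 1)) * X ^ 2 * jConvergent b lam N (m + 1)) 1

/-- The convergents are genuine quotients. -/
theorem jConvergent_succ_spec {R : Type*} [CommRing R] (b lam : ℕ → R) (N m : ℕ) :
    (1 - PowerSeries.C (b m) * X
        - PowerSeries.C (lam (m + 1)) * X ^ 2 * jConvergent b lam N (m + 1))
      * jConvergent b lam (N + 1) m = 1 := by
  rw [jConvergent]
  exact PowerSeries.mul_invOfUnit _ 1 (by simp)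

/-- `F` equals the infinite J-fraction
`1 / (1 - b₀ x - λ₁ x² / (1 - b₁ x - λ₂ x² / (1 - b₂ x - ⋯)))`: the convergents of the J-fraction
converge to `F` in the `x`-adic topology, that is, each coefficient is eventually that of `F`. -/
def IsJFraction {R : Type*} [CommRing R] (F : R⟦X⟧) (b lam : ℕ → R) : Prop :=
  ∀ n : ℕ, ∀ᶠ N in atTop, PowerSeries.coeff n (jConvergent b lam N 0) = PowerSeries.coeff n F

end JFraction

end QEulerian

end

/-!
Write `y` for the inner variable, and put `a_j = [j+1]_q - y q^(-j) [j]_q` and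
`w_j = y^j q^(-j²) - y^(j+1) q^(-(j+1)²)`. Summing the defining formula of `A k n` over `k`, with
`j = k - i` held fixed, collapses the binomial coefficients into an `n`-th power and gives
`∑_k A_{k,n} y^k = ∑_j w_j a_j^n` (`coeff_sum_weight_node_pow`): the polynomials in question are the
moments of a discrete measure with mass `w_j` at `a_j`. The sum converges `y`-adically, and
throughout it is replaced by its partial sums `j < N`, which are correct modulo `y^N`.

The integral of the Newton polynomial `∏_{i<k} (t - a_i)` against this measure is
`y^k ∏_{i<k} q^(-i) [i+1]_q`, by a telescoping sum (`weight_mul_newton_telescope`).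

On the other side, the coefficient of `x^n` in a J-fraction is the corner entry of the `n`-th power
of the tridiagonal matrix with diagonal `b_m`, entries `1` above it and `λ_m` below it
(`isJFraction_of_jacobi_pow`). The two sides are compared through the vectors
`u_k(m) = ∫ P_m(t) ∏_{i<k} (t - a_i)`, with `P_m` the orthogonal polynomials of the measure. They
have a product formula, which serves as their definition (`momentVec`), so that the `P_m` themselves
are not needed: the vectors satisfy `J u_k = u_{k+1} + a_k u_k` (`jacobi_momentVec`), just as
multiplication by `t` acts on the Newton polynomials, and the entry `u_k(0)` is the integral of the
`k`-th Newton polynomial. By induction on `n`, `∫ t^n ∏_{i<k} (t - a_i) = (J^n u_k)(0)`; since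
`u_0` is the first basis vector, `k = 0` is the claim.
-/

open LaurentPolynomial PowerSeries Filter

noncomputable section

namespace QEulerian

/-! ### J-fractions and tridiagonal matrices -/

section Jacobi

variable {R : Type*} [CommRing R]

/-- The action on column vectors of the infinite tridiagonal matrix with diagonal entries `b m`,
superdiagonal entries `1` and subdiagonal entries `lam (m + 1)`; the value `lam 0` is not used. -/
def jacobi (b lam : ℕ → R) : (ℕ → R) →ₗ[R] (ℕ → R) where
  toFun u m := u (m + 1) + b m * u m + Nat.casesOn m 0 fun l => lam (l + 1) * u l
  map_add' u v := by
    ext m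
    cases m <;> simp <;> ring
  map_smul' c u := by
    ext m
    cases m <;> simp <;> ring

theorem jacobi_zero (b lam : ℕ → R) (u : ℕ → R) :
    jacobi b lam u 0 = u 1 + b 0 * u 0 := by
  simp [jacobi]

theorem jacobi_succ (b lam : ℕ → R) (u : ℕ → R) (m : ℕ) :
    jacobi b lam u (m + 1) = u (m + 2) + b (m + 1) * u (m + 1) + lam (m + 1) * u m := rfl

/-- If `G m` is the generating function of the `m`-th entries of `Jⁿ e₀`, then `G (m + 1) / G m` is
`λ_{m+1} x` times the J-fraction that starts at level `m + 1`. -/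
theorem X_pow_dvd_sub_jConvergent (b lam : ℕ → R) (G : ℕ → R⟦X⟧)
    (hG : ∀ m, G (m + 1) =
      X * (G (m + 2) + PowerSeries.C (b (m + 1)) * G (m + 1) + PowerSeries.C (lam (m + 1)) * G m))
    (N m : ℕ) :
    X ^ N ∣ G (m + 1) - PowerSeries.C (lam (m + 1)) * X * jConvergent b lam N (m + 1) * G m := by
  induction N generalizing m with
  | zero => simp
  | succ N ih =>
    obtain ⟨d, hd⟩ := ih (m + 1)
    refine ⟨jConvergent b lam (N + 1) (m + 1) * d, ?_⟩
    linear_combination (-G (m + 1)) * jConvergent_succ_spec b lam N (m + 1) +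
      jConvergent b lam (N + 1) (m + 1) * hG m + X * jConvergent b lam (N + 1) (m + 1) * hd

theorem isJFraction_of_jacobi_pow (b lam : ℕ → R) (F : R⟦X⟧)
    (hF : ∀ n, PowerSeries.coeff n F = (jacobi b lam ^ n) (Pi.single 0 1) 0) :
    IsJFraction F b lam := by
  set v : ℕ → ℕ → R := fun n => (jacobi b lam ^ n) (Pi.single 0 1) with hv
  have hv' (n : ℕ) : v (n + 1) = jacobi b lam (v n) := by
    simp only [hv, pow_succ', Module.End.mul_apply]
  set G : ℕ → R⟦X⟧ := fun m => PowerSeries.mk fun n => v n m with hGdef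
  have hFG : F = G 0 := by
    ext n
    simp [hGdef, hF, hv]
  have hG0 : G 0 = 1 + X * (G 1 + PowerSeries.C (b 0) * G 0) := by
    ext n
    cases n with
    | zero => simp [hGdef, hv]
    | succ n =>
      simp [hGdef, coeff_succ_X_mul, hv', jacobi_zero, PowerSeries.coeff_one]
  have hG (m : ℕ) : G (m + 1) = X * (G (m + 2) + PowerSeries.C (b (m + 1)) * G (m + 1) +
      PowerSeries.C (lam (m + 1)) * G m) := by
    ext n
    cases n with
    | zero => simp [hGdef, hv]
    | succ n => simp [hGdef, coeff_succ_X_mul, hv', jacobi_succ]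
  intro n
  filter_upwards [eventually_gt_atTop n] with N hN
  obtain ⟨N, rfl⟩ : ∃ M, N = M + 1 := ⟨N - 1, by omega⟩
  have hdvd : X ^ (N + 1) ∣ F - jConvergent b lam (N + 1) 0 := by
    obtain ⟨d, hd⟩ := X_pow_dvd_sub_jConvergent b lam G hG N 0
    refine ⟨jConvergent b lam (N + 1) 0 * d, ?_⟩
    rw [hFG]
    linear_combination (-G 0) * jConvergent_succ_spec b lam N 0 +
      jConvergent b lam (N + 1) 0 * hG0 + X * jConvergent b lam (N + 1) 0 * hd
  have := PowerSeries.X_pow_dvd_iff.1 hdvd n hN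
  rw [map_sub, sub_eq_zero] at this
  exact this.symm

end Jacobi

/-! ### Arithmetic of `q`-integers -/

theorem qInt_zero : qInt 0 = 0 := by simp [qInt]

theorem qInt_succ (n : ℕ) : qInt (n + 1) = 1 + T 1 * qInt n := by
  rw [qInt, Finset.sum_range_succ', qInt, Finset.mul_sum, add_comm]
  congr 1
  · refine Finset.sum_congr rfl fun i _ => ?_
    rw [← T_add]
    congr 1
    push_cast
    ring

theorem T_natCast (n : ℕ) : (T (n : ℤ) : ℤ[T;T⁻¹]) = 1 + (T 1 - 1) * qInt n := by
  have h : qInt (n + 1) = qInt n + T (n : ℤ) := Finset.sum_range_succ _ _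
  linear_combination qInt_succ n - h

/-- The powers of `q` as elements of the ring of power series in `y`. -/
def qPow (n : ℤ) : (ℤ[T;T⁻¹])⟦X⟧ := PowerSeries.C (T n)

/-- The `q`-integers as elements of the ring of power series in `y`. -/
def qNum (n : ℕ) : (ℤ[T;T⁻¹])⟦X⟧ := PowerSeries.C (qInt n)

theorem qPow_zero : qPow 0 = 1 := by simp [qPow]

theorem qPow_add (m n : ℤ) : qPow (m + n) = qPow m * qPow n := by
  rw [qPow, T_add, map_mul, qPow, qPow]

theorem qPow_pow (m : ℤ) (n : ℕ) : qPow m ^ n = qPow (n * m) := by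
  rw [qPow, ← map_pow, T_pow, qPow]

theorem qNum_zero : qNum 0 = 0 := by simp [qNum, qInt_zero]

theorem qNum_succ (n : ℕ) : qNum (n + 1) = 1 + qPow 1 * qNum n := by
  rw [qNum, qInt_succ, map_add, map_mul, map_one, qPow, qNum]

theorem qPow_natCast (n : ℕ) : qPow (n : ℤ) = 1 + (qPow 1 - 1) * qNum n := by
  rw [qPow, T_natCast, map_add, map_mul, map_sub, map_one, qPow, qNum]

theorem qPow_neg_mul (n : ℕ) : qPow (-n) * (1 + (qPow 1 - 1) * qNum n) = 1 := by
  rw [← qPow_natCast, ← qPow_add, neg_add_cancel, qPow_zero]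

theorem qPow_one_mul_neg_one : qPow 1 * qPow (-1) = 1 := by
  rw [← qPow_add, add_neg_cancel, qPow_zero]

/-! ### The measure and its Newton moments -/

/-- The points `a_j = [j+1]_q - y q^(-j) [j]_q` of the measure. -/
def node (j : ℕ) : (ℤ[T;T⁻¹])⟦X⟧ := qNum (j + 1) - X * qPow (-j) * qNum j

/-- The total mass `y^j q^(-j²)` of the points `a_j, a_{j+1}, …`. -/
def tailMass (j : ℕ) : (ℤ[T;T⁻¹])⟦X⟧ := X ^ j * qPow (-(j : ℤ) ^ 2)

/-- The mass `y^j q^(-j²) (1 - y q^(-2j-1))` of the point `a_j`. -/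
def weight (j : ℕ) : (ℤ[T;T⁻¹])⟦X⟧ := tailMass j * (1 - X * qPow (-2 * j - 1))

/-- The value at `a_j` of the Newton polynomial `∏_{i<k} (t - a_i)`. -/
def newton (k j : ℕ) : (ℤ[T;T⁻¹])⟦X⟧ := ∏ i ∈ Finset.range k, (node j - node i)

/-- The product `∏_{i<k} q ([j]_q - [i]_q)`, which is `∏_{i<k} q^(i+1) [j-i]_q` for `j ≥ k` and
`0` for `j < k`. -/
def qFalling (k j : ℕ) : (ℤ[T;T⁻¹])⟦X⟧ :=
  ∏ i ∈ Finset.range k, qPow 1 * (qNum j - qNum i)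

/-- The value `y^k ∏_{i<k} q^(-i) [i+1]_q` of the integral of the `k`-th Newton polynomial. -/
def newtonMoment (k : ℕ) : (ℤ[T;T⁻¹])⟦X⟧ :=
  ∏ i ∈ Finset.range k, X * qPow (-i) * qNum (i + 1)

theorem tailMass_succ (j : ℕ) : tailMass (j + 1) = tailMass j * (X * qPow (-2 * j - 1)) := by
  have : -((j + 1 : ℕ) : ℤ) ^ 2 = -(j : ℤ) ^ 2 + (-2 * j - 1) := by push_cast; ring
  rw [tailMass, tailMass, this, qPow_add]
  ring

theorem weight_eq_sub (j : ℕ) : weight j = tailMass j - tailMass (j + 1) := by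
  rw [weight, tailMass_succ]
  ring

theorem node_sub_node (j i : ℕ) :
    node j - node i = qPow 1 * (qNum j - qNum i) * (1 - X * qPow (-i - j - 1)) := by
  have h : qPow (-i - j - 1) = qPow (-i) * qPow (-j) * qPow (-1) := by
    rw [← qPow_add, ← qPow_add]
    congr 1
  rw [node, node, qNum_succ, qNum_succ, h]
  have h1 := qPow_one_mul_neg_one
  have hi := qPow_neg_mul i
  have hj := qPow_neg_mul j
  linear_combination
    X * qPow (-i) * qPow (-j) * (qNum j - qNum i) * h1
      + X * qPow (-j) * qNum j * hi - X * qPow (-i) * qNum i * hj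

theorem newton_eq (k j : ℕ) :
    newton k j = qFalling k j * ∏ i ∈ Finset.range k, (1 - X * qPow (-i - j - 1)) := by
  rw [newton, qFalling, ← Finset.prod_mul_distrib]
  exact Finset.prod_congr rfl fun i _ => node_sub_node j i

theorem newton_succ (k j : ℕ) : newton (k + 1) j = newton k j * (node j - node k) :=
  Finset.prod_range_succ _ _

theorem qFalling_succ (k j : ℕ) :
    qFalling (k + 1) j = qFalling k j * (qPow 1 * (qNum j - qNum k)) :=
  Finset.prod_range_succ _ _

theorem qFalling_succ_succ (k j : ℕ) :
    qFalling (k + 1) (j + 1) = qPow 1 * qNum (j + 1) * qPow k * qFalling k j := by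
  have h (i : ℕ) : qPow 1 * (qNum (j + 1) - qNum (i + 1)) =
      qPow 1 * (qPow 1 * (qNum j - qNum i)) := by
    rw [qNum_succ, qNum_succ]
    ring
  rw [qFalling, Finset.prod_range_succ', Finset.prod_congr rfl fun i _ => h i,
    Finset.prod_mul_distrib, Finset.prod_const, Finset.card_range, qPow_pow, qNum_zero, qFalling]
  simp only [mul_one, sub_zero]
  ring

theorem qFalling_succ_zero (k : ℕ) : qFalling (k + 1) 0 = 0 := by
  rw [qFalling, Finset.prod_range_succ', sub_self, mul_zero, mul_zero]

theorem newtonMoment_succ (k : ℕ) :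
    newtonMoment (k + 1) = newtonMoment k * (X * qPow (-k) * qNum (k + 1)) :=
  Finset.prod_range_succ _ _

/-- The discrete antiderivative, up to sign, of `weight j * (newton (k + 1) j - c * newton k j)`,
where `c` is the ratio of consecutive Newton moments. -/
def telescoper (k j : ℕ) : (ℤ[T;T⁻¹])⟦X⟧ :=
  tailMass j * qFalling (k + 1) j * ∏ i ∈ Finset.range (k + 1), (1 - X * qPow (-i - j))

/-- The cofactor identity behind `weight_mul_newton_telescope`, with `s = q^(-j)`, `t = q^(-k)`,
`a = [j]_q` and `b = [k]_q`. -/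
theorem telescope_identity {R : Type*} [CommRing R] (y q r s t a b : R) (hr : q * r = 1)
    (hs : s * (1 + (q - 1) * a) = 1) (ht : t * (1 + (q - 1) * b) = 1) :
    (1 - y * (s * s * r)) *
        (q * (a - b) - y * s * a + y * t * b - y * t * (1 + q * b)) =
      q * (a - b) * (1 - y * s) -
        y * (s * s * r) * (q * (1 + q * a) * (1 + (q - 1) * b)) * (1 - y * (t * s * r)) := by
  linear_combination
    (y * (s * s * (1 + q * a) * (1 + (q - 1) * b) - s * s * (a - b))
      - y ^ 2 * s ^ 3 * r * (1 + q * a) * (1 + (q - 1) * b) * t) * hr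
    + (y * (s * (1 + (q - 1) * b) + s * b + 1) - y ^ 2 * s ^ 2 * r) * hs
    + (y ^ 2 * s ^ 2 * r - y - y ^ 2 * s ^ 3 * r * (1 + q * a)) * ht

theorem weight_mul_newton_telescope (k j : ℕ) :
    weight j * (newton (k + 1) j - X * qPow (-k) * qNum (k + 1) * newton k j) =
      telescoper k j - telescoper k (j + 1) := by
  set B := ∏ i ∈ Finset.range k, (1 - X * qPow (-i - j - 1)) with hB
  have hprod : ∏ i ∈ Finset.range (k + 1), (1 - X * qPow (-i - j)) =
      B * (1 - X * qPow (-j)) := by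
    have h (i : ℕ) : (-(i + 1 : ℕ) - j : ℤ) = -i - j - 1 := by push_cast; ring
    simp only [Finset.prod_range_succ', h, hB, Nat.cast_zero, neg_zero, zero_sub]
  have hprod' : ∏ i ∈ Finset.range (k + 1), (1 - X * qPow (-i - (j + 1 : ℕ))) =
      B * (1 - X * (qPow (-k) * qPow (-j) * qPow (-1))) := by
    have h (i : ℕ) : (-i - (j + 1 : ℕ) : ℤ) = -i - j - 1 := by push_cast; ring
    simp only [Finset.prod_range_succ, h, hB, ← qPow_add, ← sub_eq_add_neg]
  have hj2 : qPow (-2 * j - 1) = qPow (-j) * qPow (-j) * qPow (-1) := by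
    rw [← qPow_add, ← qPow_add]
    congr 1
    ring
  rw [newton_succ, newton_eq, ← hB, telescoper, telescoper, hprod, hprod', qFalling_succ,
    qFalling_succ_succ, tailMass_succ, weight, hj2, qPow_natCast, node, node, qNum_succ, qNum_succ]
  have key := telescope_identity X (qPow 1) (qPow (-1)) (qPow (-j)) (qPow (-k)) (qNum j) (qNum k)
    qPow_one_mul_neg_one (qPow_neg_mul j) (qPow_neg_mul k)
  linear_combination tailMass j * qFalling k j * B * key

theorem X_pow_dvd_telescoper (k N : ℕ) : X ^ N ∣ telescoper k N := by
  rw [telescoper, tailMass]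
  exact ((Dvd.intro _ rfl).mul_right _).mul_right _

theorem sum_weight (N : ℕ) : ∑ j ∈ Finset.range N, weight j = 1 - tailMass N := by
  simp only [weight_eq_sub]
  rw [Finset.sum_range_sub']
  simp [tailMass, qPow_zero]

theorem sum_weight_mul_newton (N k : ℕ) :
    X ^ N ∣ ∑ j ∈ Finset.range N, weight j * newton k j - newtonMoment k := by
  induction k with
  | zero =>
    simp only [newton, newtonMoment, Finset.prod_range_zero, mul_one, sum_weight]
    rw [sub_sub_cancel_left, dvd_neg, tailMass]
    exact Dvd.intro _ rfl
  | succ k ih =>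
    have h : ∑ j ∈ Finset.range N, weight j * newton (k + 1) j =
        X * qPow (-k) * qNum (k + 1) * ∑ j ∈ Finset.range N, weight j * newton k j
          - telescoper k N := by
      have h0 : telescoper k 0 = 0 := by simp [telescoper, qFalling_succ_zero]
      have h1 := Finset.sum_range_sub' (telescoper k) N
      rw [Finset.sum_congr rfl fun j _ => (weight_mul_newton_telescope k j).symm, h0] at h1
      simp only [mul_sub, Finset.sum_sub_distrib] at h1
      have h2 : ∑ j ∈ Finset.range N, weight j * (X * qPow (-k) * qNum (k + 1) * newton k j) =
          X * qPow (-k) * qNum (k + 1) * ∑ j ∈ Finset.range N, weight j * newton k j := by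
        rw [Finset.mul_sum]
        exact Finset.sum_congr rfl fun j _ => by ring
      linear_combination h1 + h2
    rw [h, newtonMoment_succ]
    convert dvd_sub (ih.mul_left (X * qPow (-k) * qNum (k + 1))) (X_pow_dvd_telescoper k N) using 1
    ring

/-! ### The moment vectors -/

/-- The vector `u_k` of the integrals of `P_m(t) ∏_{i<k} (t - a_i)`, where the `P_m` are the monic
orthogonal polynomials of the measure, in closed form. -/
def momentVec (k m : ℕ) : (ℤ[T;T⁻¹])⟦X⟧ := newtonMoment k * qFalling m k

theorem momentVec_zero : momentVec 0 = Pi.single 0 1 := by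
  ext1 m
  cases m with
  | zero => simp [momentVec, newtonMoment, qFalling]
  | succ m => simp [momentVec, qFalling_succ_zero]

/-- The identity behind `jacobi_momentVec`, with `s = q^(-k)`, `a = [k]_q` and `b = [m]_q`. -/
theorem jacobi_identity {R : Type*} [CommRing R] (y q s a b : R)
    (hs : s * (1 + (q - 1) * a) = 1) :
    q * (a - b) * (q * (a - (1 + q * b))) + (1 + y) * (1 + q * (1 + q * b)) * (q * (a - b)) +
        y * (q * (1 + q * b) ^ 2) =
      y * s * (1 + q * a) * (q * (1 + q * a) * (1 + (q - 1) * b)) +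
        (1 + q * a - y * s * a) * (q * (a - b)) := by
  linear_combination (-y * q * ((1 + (q - 1) * b) * (1 + q * a + a) + a * b)) * hs

theorem jacobi_momentVec (k : ℕ) :
    jacobi (fun n => (1 + X) * qNum (n + 1)) (fun n => X * (qPow 1 * qNum n ^ 2)) (momentVec k) =
      momentVec (k + 1) + node k • momentVec k := by
  have hk := qPow_neg_mul k
  ext1 m
  cases m with
  | zero =>
    rw [jacobi_zero]
    simp only [momentVec, Pi.add_apply, Pi.smul_apply, smul_eq_mul, newtonMoment_succ, qFalling,
      Finset.prod_range_zero, Finset.prod_range_one, node, qNum_succ, qNum_zero]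
    linear_combination (-newtonMoment k * X) * hk
  | succ m =>
    rw [jacobi_succ]
    simp only [momentVec, Pi.add_apply, Pi.smul_apply, smul_eq_mul, newtonMoment_succ,
      qFalling_succ_succ, qFalling_succ, node, qNum_succ, qPow_natCast]
    linear_combination newtonMoment k * qFalling m k *
      jacobi_identity X (qPow 1) (qPow (-k)) (qNum k) (qNum m) hk

/-- The integral of `t^n ∏_{i<k} (t - a_i)` is the entry `(Jⁿ u_k)(0)`, modulo `y^N` when the
measure is truncated to its first `N` points. -/
theorem sum_weight_mul_node_pow_mul_newton (N n k : ℕ) :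
    X ^ N ∣ ∑ j ∈ Finset.range N, weight j * (node j ^ n * newton k j) -
      (jacobi (fun n => (1 + X) * qNum (n + 1)) (fun n => X * (qPow 1 * qNum n ^ 2)) ^ n)
        (momentVec k) 0 := by
  induction n generalizing k with
  | zero => simpa [momentVec, qFalling] using sum_weight_mul_newton N k
  | succ n ih =>
    rw [pow_succ, Module.End.mul_apply, jacobi_momentVec, map_add, map_smul]
    convert dvd_add (ih (k + 1)) ((ih k).mul_left (node k)) using 1
    have h : ∑ j ∈ Finset.range N, weight j * (node j ^ (n + 1) * newton k j) =
        ∑ j ∈ Finset.range N, weight j * (node j ^ n * newton (k + 1) j) +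
          node k * ∑ j ∈ Finset.range N, weight j * (node j ^ n * newton k j) := by
      rw [Finset.mul_sum, ← Finset.sum_add_distrib]
      refine Finset.sum_congr rfl fun j _ => ?_
      rw [newton_succ]
      ring
    rw [h, Pi.add_apply, Pi.smul_apply, smul_eq_mul]
    ring

/-! ### The `q`-Eulerian numbers as moments -/

theorem coeff_one_sub_X_mul_C_pow {S : Type*} [CommRing S] (c : S) (n i : ℕ) :
    PowerSeries.coeff i ((1 - X * PowerSeries.C c) ^ n) = (-c) ^ i * (n.choose i : S) := by
  have h : (1 - X * PowerSeries.C c) ^ n = rescale (-c) ((1 + X) ^ n) := by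
    rw [map_pow, map_add, map_one, rescale_X, map_neg]
    ring
  have h' : ((1 + X) ^ n : S⟦X⟧) = ((1 + Polynomial.X : Polynomial S) ^ n : Polynomial S) := by
    simp
  rw [h, coeff_rescale, h', Polynomial.coeff_coe, Polynomial.coeff_one_add_X_pow]

theorem node_sub_one (j : ℕ) :
    node j - 1 = PowerSeries.C (T 1 * qInt j) * (1 - X * PowerSeries.C (T (-j - 1))) := by
  have h0 : node 0 = 1 := by rw [node, qNum_succ, qNum_zero]; ring
  have h := node_sub_node j 0
  rwa [h0, qNum_zero, sub_zero, Nat.cast_zero, neg_zero, zero_sub, qPow, qNum, qPow,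
    ← map_mul] at h

theorem coeff_weight_mul (n i j : ℕ) :
    PowerSeries.coeff (j + i) (weight j * (node j - 1) ^ n) =
      T (n - (j : ℤ) ^ 2) * qInt j ^ n * (-1) ^ i *
        ((n.choose i : ℤ[T;T⁻¹]) * T (-(j + 1) * i) +
          (choosePred n i : ℤ[T;T⁻¹]) * T (-(j + 1) * i - j)) := by
  set F : (ℤ[T;T⁻¹])⟦X⟧ := (1 - X * PowerSeries.C (T (-j - 1))) ^ n with hF
  have hp : PowerSeries.C ((T 1 * qInt j) ^ n) = PowerSeries.C (T 1 * qInt j) ^ n := map_pow _ _ _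
  have h : weight j * (node j - 1) ^ n = X ^ j * (PowerSeries.C (T (-(j : ℤ) ^ 2) *
      (T 1 * qInt j) ^ n) * (F - X * (PowerSeries.C (T (-2 * j - 1)) * F))) := by
    rw [node_sub_one, weight, tailMass, mul_pow, ← hF, ← hp, map_mul, qPow, qPow]
    ring
  have hc : (T (n - (j : ℤ) ^ 2) : ℤ[T;T⁻¹]) = T (-(j : ℤ) ^ 2) * T 1 ^ n := by
    rw [T_pow, ← T_add]
    congr 1
    ring
  rw [h, add_comm, PowerSeries.coeff_X_pow_mul, PowerSeries.coeff_C_mul, map_sub, hc, mul_pow]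
  cases i with
  | zero =>
    rw [hF, coeff_one_sub_X_mul_C_pow, PowerSeries.coeff_zero_X_mul]
    rw [choosePred, if_pos rfl, Nat.cast_zero, Nat.cast_zero, mul_zero, T_zero]
    ring
  | succ i =>
    have h1 : (T (-(j + 1) * (i + 1 : ℕ)) : ℤ[T;T⁻¹]) = T (-j - 1) ^ (i + 1) := by
      rw [T_pow]
      congr 1
      push_cast
      ring
    have h2 : (T (-(j + 1) * (i + 1 : ℕ) - j) : ℤ[T;T⁻¹]) = T (-2 * j - 1) * T (-j - 1) ^ i := by
      rw [T_pow, ← T_add]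
      congr 1
      push_cast
      ring
    rw [PowerSeries.coeff_succ_X_mul, PowerSeries.coeff_C_mul, hF, coeff_one_sub_X_mul_C_pow,
      coeff_one_sub_X_mul_C_pow, h1, h2, choosePred, if_neg i.succ_ne_zero, Nat.add_sub_cancel,
      neg_pow, neg_pow (T (-j - 1) : ℤ[T;T⁻¹]) i]
    ring

/-- The moments of the measure translated by `-1` are the generating polynomials of the `E k n`; the
binomial transform that defines `A k n` undoes the translation. -/
theorem coeff_sum_weight (k n : ℕ) :
    PowerSeries.coeff k (∑ j ∈ Finset.range (k + 1), weight j * (node j - 1) ^ n) = E k n := by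
  rcases eq_or_ne n 0 with rfl | hn
  · have h : PowerSeries.coeff k (tailMass (k + 1)) = 0 :=
      PowerSeries.X_pow_dvd_iff.1 (Dvd.intro _ rfl) k k.lt_succ_self
    simp only [pow_zero, mul_one]
    rw [sum_weight, map_sub, h, sub_zero, PowerSeries.coeff_one, E, hatE, if_pos rfl]
    split_ifs with hk <;> simp [hk]
  · -- the substitution `j = k - i`; the term with `j = 0` vanishes because `n ≠ 0`
    rw [← Finset.sum_flip, Finset.sum_range_succ, Nat.sub_self, node_sub_one, qInt_zero, mul_zero,
      map_zero, zero_mul, zero_pow hn, mul_zero, add_zero, map_sum, E, hatE, if_neg hn,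
      Finset.mul_sum, Finset.mul_sum]
    refine Finset.sum_congr rfl fun i hi => ?_
    obtain ⟨j, rfl⟩ := Nat.exists_eq_add_of_le' (Finset.mem_range.1 hi).le
    rw [Nat.add_sub_cancel, coeff_weight_mul]
    have h1 : (T (n - (j : ℤ) ^ 2) * T (-(j + 1) * i) : ℤ[T;T⁻¹]) =
        T (n - (j + i : ℕ)) * T ((j + i : ℕ) - ((j + i : ℕ) : ℤ) ^ 2) *
          T ((j + i : ℕ) * ((i : ℤ) - 1)) * T ((j + i : ℕ) - (i : ℤ)) := by
      simp only [← T_add]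
      congr 1
      push_cast
      ring
    have h2 : (T (n - (j : ℤ) ^ 2) * T (-(j + 1) * i - j) : ℤ[T;T⁻¹]) =
        T (n - (j + i : ℕ)) * T ((j + i : ℕ) - ((j + i : ℕ) : ℤ) ^ 2) *
          T ((j + i : ℕ) * ((i : ℤ) - 1)) := by
      simp only [← T_add]
      congr 1
      push_cast
      ring
    linear_combination qInt j ^ n * (-1) ^ i * (n.choose i : ℤ[T;T⁻¹]) * h1 +
      qInt j ^ n * (-1) ^ i * (choosePred n i : ℤ[T;T⁻¹]) * h2

theorem coeff_sum_weight_node_pow (k n : ℕ) :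
    PowerSeries.coeff k (∑ j ∈ Finset.range (k + 1), weight j * node j ^ n) = A k n := by
  have h (j : ℕ) : weight j * node j ^ n = ∑ i ∈ Finset.range (n + 1),
      (n.choose i : (ℤ[T;T⁻¹])⟦X⟧) * (weight j * (node j - 1) ^ (n - i)) := by
    conv_lhs => rw [show node j = 1 + (node j - 1) by ring, add_pow]
    rw [Finset.mul_sum]
    refine Finset.sum_congr rfl fun i _ => ?_
    rw [one_pow]
    ring
  rw [Finset.sum_congr rfl fun j _ => h j, Finset.sum_comm, map_sum, A]
  refine Finset.sum_congr rfl fun i _ => ?_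
  rw [← Finset.mul_sum, ← coeff_sum_weight, ← map_natCast (PowerSeries.C (R := ℤ[T;T⁻¹])),
    PowerSeries.coeff_C_mul]

end QEulerian

end

theorem mainTheorem6 :
    QEulerian.IsJFraction QEulerian.genA
      (fun n => (1 + (PowerSeries.X : PowerSeries (LaurentPolynomial ℤ))) *
        PowerSeries.C (QEulerian.qInt (n + 1)))
      (fun n => (PowerSeries.X : PowerSeries (LaurentPolynomial ℤ)) *
        PowerSeries.C (LaurentPolynomial.T 1 * QEulerian.qInt n ^ 2)) := by
  refine QEulerian.isJFraction_of_jacobi_pow _ _ _ fun n => ?_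
  refine PowerSeries.ext fun k => ?_
  have h := PowerSeries.X_pow_dvd_iff.1
    (QEulerian.sum_weight_mul_node_pow_mul_newton (k + 1) n 0) k k.lt_succ_self
  rw [map_sub, sub_eq_zero, QEulerian.momentVec_zero] at h
  simp only [QEulerian.newton, Finset.prod_range_zero, mul_one,
    QEulerian.coeff_sum_weight_node_pow, QEulerian.qNum, QEulerian.qPow, ← map_pow,
    ← map_mul] at h
  simpa [QEulerian.genA] using h
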